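/- Theorem 5.2. Let $\mathcal T$ be the Stern–Brocot tree: its level $1$ consists of the root $1/1$, the mediant of the initial pair $0/1<1/0$, and every element of $\mathcal T$, which is the mediant $x=\frac{m+n}{s+t}$ of its parents $\frac ms<\frac nt$ (nonnegative fractions with $ns-mt=1$), has as left and right child the mediant of $\frac ms$ and $x$ and the mediant of $x$ and $\frac nt$. Let $r_1,r_2,r_3,\dots$ be the elements of $\mathcal T$ read row by row, from left to right, starting from the root; thus the $k$-th element of level $n$ $(1\le k\le 2^{n-1})$ is $r_m$ with $m=2^{n-1}+(k-1)$. To $g=\begin{pmatrix}a&b\\c&d\end{pmatrix}\in SL(2,\mathbb R)$ associate the unit tangent vector $v_g$ of the hyperbolic upper half-plane with base point $g(i)$ and direction $g'(i)\,i=i/(ci+d)^2$. This identifies $PSL(2,\mathbb R)$ with the unit tangent bundle $S\mathbb H$, and $SL(2,\mathbb R)$ acts on $S\mathbb H$ by right multiplication, $v_g\cdot M=v_{gM}$. For real $\tau$ put $$A^\tau=\begin{pmatrix}1&0\\ \tau&1\end{pmatrix},\qquad D^\tau=\begin{pmatrix}1&-\tau\\0&1\end{pmatrix};$$ the right actions of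 $A^\tau$ and $D^\tau$ are the negative horocyclic flow at time $\tau$ and the positive horocyclic flow at time $-\tau$. For coprime integers $p,q\ge 0$ the Ford circle $C_{p/q}$ is the circle of diameter $1/q^2$ tangent to the real line at $p/q$ from above if $q\neq0$, and the horizontal line $\{\operatorname{Im} z=1\}$ if $q=0$, on which "clockwise" means leftwards. Say that $v\in S\mathbb H$ corresponds to $x=\frac{m+n}{s+t}\in\mathcal T$ with parents $\frac ms<\frac nt$ if $v$ is $v_X$ or its opposite vector, where $X=\begin{pmatrix}n&m\\t&s\end{pmatrix}$. Then the horizontal displacement on $\mathcal T$ is a clockwise motion along Ford circles. Precisely, there are vectors $v_m\in S\mathbb H$ $(m\ge1)$, with $v_1=(i,\text{upward})$ and $v_m$ corresponding to $r_m$ for all $m\ge 1$, such that for all $n\ge1$: - if $r_m$ is the rightmost element of level $n$, i.e. $m=2^n-1$, then $v_{m+1}=v_m\cdot D^{n-1}A^n$ if $n$ is odd, and $v_{m+1}=v_m\cdot A^{n-1}D^n$ if $n$ is even; - if $m=2^{n-1}+(k-1)$ with $1\le k<2^{n-1}$, and $k\equiv 2^{p-1}\pmod{2^p}$ with $p\ge1$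 (so that $p\le n-1$), then $v_{m+1}=v_m\cdot A^{1+2(p-1)}$ if $n\equiv k\pmod 2$, and $v_{m+1}=v_m\cdot D^{1+2(p-1)}$ otherwise. Moreover, for each factor $A^T$ or $D^T$ in these displacements, applied from left to right, if $v$ is the vector to which the factor is applied, then the base points of $v\cdot A^\tau$, respectively $v\cdot D^\tau$, $0\le\tau\le T$, move clockwise along a single Ford circle $C_{p'/q'}$ with coprime integers $p',q'\ge0$. -/

import Mathlib

open scoped MatrixGroups UpperHalfPlane

noncomputable section

namespace SternBrocot

/- ### The Stern-Brocot tree -/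

/-- A Farey pair of nonnegative fractions `m / s < n / t`, written by numerators and denominators
(the fraction `1 / 0` is allowed), satisfying the unimodular relation `n s - m t = 1`. -/
structure FareyPair where
  m : ℕ
  s : ℕ
  n : ℕ
  t : ℕ
  unimodular : n * s = m * t + 1

namespace FareyPair

/-- The initial pair `0 / 1`, `1 / 0`. -/
def root : FareyPair := ⟨0, 1, 1, 0, rfl⟩

/-- The mediant `(m + n) / (s + t)`, i.e. the child of the two fractions. -/
def mediant (P : FareyPair) : ℚ := ((P.m + P.n : ℕ) : ℚ) / ((P.s + P.t : ℕ) : ℚ)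

/-- The pair formed by the left parent and the mediant. -/
def left (P : FareyPair) : FareyPair :=
  ⟨P.m, P.s, P.m + P.n, P.s + P.t, by have := P.unimodular; nlinarith⟩

/-- The pair formed by the mediant and the right parent. -/
def right (P : FareyPair) : FareyPair :=
  ⟨P.m + P.n, P.s + P.t, P.n, P.t, by have := P.unimodular; nlinarith⟩

/-- The matrix `X = (n m; t s)`, whose value at `1` is the mediant of `m / s` and `n / t`. -/
def toSL (P : FareyPair) : SL(2, ℝ) :=
  ⟨!![(P.n : ℝ), (P.m : ℝ); (P.t : ℝ), (P.s : ℝ)], by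
    have h : (P.n : ℝ) * P.s = P.m * P.t + 1 := by exact_mod_cast P.unimodular
    rw [Matrix.det_fin_two_of]; linarith⟩

end FareyPair

/-- The successive generations of Farey pairs; the first one consists of the initial pair only.
There is no generation `0`. -/
def pairs : ℕ → List FareyPair
  | 0 => []
  | 1 => [FareyPair.root]
  | (j + 2) => (pairs (j + 1)).flatMap fun P => [P.left, P.right]

/-- The `n`-th level of the Stern-Brocot tree (`n ≥ 1`), from left to right: the mediants of the
`n`-th generation of Farey pairs. The depth of an element is the number of its level. -/
def level (n : ℕ) : List ℚ := (pairs n).map FareyPair.mediant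

/-- The `m`-th element (`m ≥ 1`) of the tree, read row by row, from left to right, starting from
the root. The first `m` rows have at least `m` entries, so the default value occurs at `m = 0`
only. -/
def r (m : ℕ) : ℚ := ((List.range (m + 1)).flatMap level).getD (m - 1) 0

/- ### The unit tangent bundle of the hyperbolic plane and the horocyclic flows -/

/-- A unit tangent vector of the upper half-plane with the metric `(dx ^ 2 + dy ^ 2) / y ^ 2`. -/
@[ext] structure UnitTangent where
  base : ℍ
  dir : ℂ
  norm_dir : ‖dir‖ = base.im

namespace UnitTangent

/-- The opposite vector at the same point. -/
def opposite (v : UnitTangent) : UnitTangent := ⟨v.base, -v.dir, by rw [norm_neg, v.norm_dir]⟩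

theorem coe_smul_I (g : SL(2, ℝ)) : ((g • UpperHalfPlane.I : ℍ) : ℂ) =
    ((g 0 0 : ℂ) * Complex.I + (g 0 1 : ℂ)) / ((g 1 0 : ℂ) * Complex.I + (g 1 1 : ℂ)) := by
  rw [UpperHalfPlane.coe_specialLinearGroup_apply]
  simp

theorem det_eq (g : SL(2, ℝ)) : g 0 0 * g 1 1 - g 0 1 * g 1 0 = 1 := by
  have h := g.2
  rwa [Matrix.det_fin_two] at h

theorem normSq_denom (c d : ℝ) :
    Complex.normSq ((c : ℂ) * Complex.I + (d : ℂ)) = c ^ 2 + d ^ 2 := by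
  simp [Complex.normSq_apply]; ring

theorem denom_ne_zero (g : SL(2, ℝ)) : (g 1 0 : ℂ) * Complex.I + (g 1 1 : ℂ) ≠ 0 := by
  intro h
  have h1 := normSq_denom (g 1 0) (g 1 1)
  rw [h, map_zero] at h1
  have hc : g 1 0 = 0 := by nlinarith [sq_nonneg (g 1 0), sq_nonneg (g 1 1)]
  have hd : g 1 1 = 0 := by nlinarith [sq_nonneg (g 1 0), sq_nonneg (g 1 1)]
  have := det_eq g
  rw [hc, hd] at this
  norm_num at this

/-- The vector corresponding to `g = (a b; c d)`: its base point is `g(i)` and its direction is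
`g'(i) ζ₀ = ζ₀ / (c i + d) ^ 2`, where `ζ₀ = i` is the upward unit vector at `i`. -/
def ofSL (g : SL(2, ℝ)) : UnitTangent where
  base := g • UpperHalfPlane.I
  dir := Complex.I / ((g 1 0 : ℂ) * Complex.I + (g 1 1 : ℂ)) ^ 2
  norm_dir := by
    rw [← UpperHalfPlane.coe_im, coe_smul_I, norm_div, norm_pow, Complex.norm_I,
      ← Complex.normSq_eq_norm_sq, Complex.div_im, normSq_denom]
    have h := det_eq g
    have hpos : 0 < g 1 0 ^ 2 + g 1 1 ^ 2 := by
      rw [← normSq_denom]; exact Complex.normSq_pos.mpr (denom_ne_zero g)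
    simp
    field_simp
    linarith

/-- Every unit tangent vector comes from some `g`. -/
theorem exists_ofSL (v : UnitTangent) : ∃ g : SL(2, ℝ), ofSL g = v := by
  have hy : 0 < v.base.im := v.base.im_pos
  have hdir : v.dir ≠ 0 := by
    intro h; have := v.norm_dir; rw [h, norm_zero] at this; linarith
  obtain ⟨w, hw⟩ := IsAlgClosed.exists_pow_nat_eq (Complex.I / v.dir) two_pos
  have hw0 : w ≠ 0 := by
    rintro rfl
    have h0 : Complex.I / v.dir ≠ 0 := div_ne_zero Complex.I_ne_zero hdir
    apply h0
    rw [← hw]; simp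
  have hn : Complex.normSq w * v.base.im = 1 := by
    rw [Complex.normSq_eq_norm_sq, ← norm_pow, hw, norm_div, Complex.norm_I, v.norm_dir]
    field_simp
  have hwe : (w.im : ℂ) * Complex.I + (w.re : ℂ) = w := by
    rw [add_comm]; exact Complex.re_add_im w
  have hze : ((((v.base : ℂ) * w).im : ℝ) : ℂ) * Complex.I + ((((v.base : ℂ) * w).re : ℝ) : ℂ)
      = (v.base : ℂ) * w := by
    rw [add_comm]; exact Complex.re_add_im _
  have hdet : (!![((v.base : ℂ) * w).im, ((v.base : ℂ) * w).re; w.im, w.re] :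
      Matrix (Fin 2) (Fin 2) ℝ).det = 1 := by
    rw [Matrix.det_fin_two_of, Complex.mul_im, Complex.mul_re, UpperHalfPlane.coe_im]
    rw [Complex.normSq_apply] at hn
    linarith
  obtain ⟨g, h00, h01, h10, h11⟩ : ∃ g : SL(2, ℝ), g 0 0 = ((v.base : ℂ) * w).im ∧
      g 0 1 = ((v.base : ℂ) * w).re ∧ g 1 0 = w.im ∧ g 1 1 = w.re :=
    ⟨⟨_, hdet⟩, rfl, rfl, rfl, rfl⟩
  refine ⟨g, ?_⟩
  ext1
  · apply UpperHalfPlane.ext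
    simp only [ofSL]
    rw [coe_smul_I, h00, h01, h10, h11, hze, hwe]
    field_simp
  · simp only [ofSL]
    rw [h10, h11, hwe, hw]
    field_simp

/-- Two matrices give the same vector only if they agree up to sign. -/
theorem eq_or_eq_neg_of_ofSL_eq {g h : SL(2, ℝ)} (e : ofSL g = ofSL h) : g = h ∨ g = -h := by
  have hb : ((g • UpperHalfPlane.I : ℍ) : ℂ) = ((h • UpperHalfPlane.I : ℍ) : ℂ) :=
    congrArg (fun v : UnitTangent => (v.base : ℂ)) e
  have hd : Complex.I / ((g 1 0 : ℂ) * Complex.I + (g 1 1 : ℂ)) ^ 2 =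
      Complex.I / ((h 1 0 : ℂ) * Complex.I + (h 1 1 : ℂ)) ^ 2 :=
    congrArg UnitTangent.dir e
  have hg0 := denom_ne_zero g
  have hh0 := denom_ne_zero h
  rw [coe_smul_I, coe_smul_I, div_eq_div_iff hg0 hh0] at hb
  have hsq : ((g 1 0 : ℂ) * Complex.I + (g 1 1 : ℂ)) ^ 2 =
      ((h 1 0 : ℂ) * Complex.I + (h 1 1 : ℂ)) ^ 2 := by
    rw [div_eq_div_iff (pow_ne_zero 2 hg0) (pow_ne_zero 2 hh0)] at hd
    exact (mul_left_cancel₀ Complex.I_ne_zero hd).symm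
  rcases sq_eq_sq_iff_eq_or_eq_neg.mp hsq with hq | hq
  · left
    rw [hq] at hb
    have hn := mul_right_cancel₀ hh0 hb
    ext i j
    fin_cases i <;> fin_cases j
    · simpa using congrArg Complex.im hn
    · simpa using congrArg Complex.re hn
    · simpa using congrArg Complex.im hq
    · simpa using congrArg Complex.re hq
  · right
    rw [hq, mul_neg, ← neg_mul] at hb
    have hn := mul_right_cancel₀ hh0 hb
    ext i j
    fin_cases i <;> fin_cases j
    · simpa using (congrArg Complex.im hn.symm).symm
    · simpa using (congrArg Complex.re hn.symm).symm
    · simpa using congrArg Complex.im hq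
    · simpa using congrArg Complex.re hq

theorem ofSL_neg (g : SL(2, ℝ)) : ofSL (-g) = ofSL g := by
  ext1
  · apply UpperHalfPlane.ext
    simp only [ofSL]
    rw [coe_smul_I, coe_smul_I]
    simp only [Matrix.SpecialLinearGroup.coe_neg, Matrix.neg_apply, Complex.ofReal_neg, neg_mul]
    rw [← neg_add, ← neg_add, neg_div_neg_eq]
  · simp only [ofSL, Matrix.SpecialLinearGroup.coe_neg, Matrix.neg_apply, Complex.ofReal_neg,
      neg_mul]
    rw [← neg_add, neg_sq]

/-- A matrix representing `v`; it is unique up to sign, see `act_ofSL`. -/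
def frame (v : UnitTangent) : SL(2, ℝ) := v.exists_ofSL.choose

theorem ofSL_frame (v : UnitTangent) : ofSL v.frame = v := v.exists_ofSL.choose_spec

/-- Right multiplication by `M` on unit tangent vectors, identified with matrices up to sign. -/
def act (v : UnitTangent) (M : SL(2, ℝ)) : UnitTangent := ofSL (v.frame * M)

theorem act_ofSL (g M : SL(2, ℝ)) : (ofSL g).act M = ofSL (g * M) := by
  rcases eq_or_eq_neg_of_ofSL_eq (ofSL_frame (ofSL g)) with h | h
  · rw [act, h]
  · rw [act, h, neg_mul, ofSL_neg]

end UnitTangent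

/-- `A ^ t = (1 0; t 1)`: right multiplication by it is the negative horocyclic flow at
time `t`. -/
def matA (t : ℝ) : SL(2, ℝ) := ⟨!![1, 0; t, 1], by simp [Matrix.det_fin_two_of]⟩

/-- `D ^ t = (1 (-t); 0 1)`: right multiplication by it is the positive horocyclic flow at
time `-t`. -/
def matD (t : ℝ) : SL(2, ℝ) := ⟨!![1, -t; 0, 1], by simp [Matrix.det_fin_two_of]⟩

/- ### Ford circles -/

/-- The continuous path `γ`, restricted to `[0, T]`, runs clockwise along the Ford circle of the
reduced fraction `p / q`. If `q ≠ 0` this is the circle of diameter `1 / q ^ 2` tangent to the real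
line at `p / q` from above, and the path has a continuous, strictly decreasing angle around
its centre. If `q = 0` it is the horizontal line through `i`, where clockwise means leftwards. -/
def ClockwiseOn (p q : ℕ) (γ : ℝ → ℍ) (T : ℝ) : Prop :=
  if q = 0 then
    (∀ s ∈ Set.Icc 0 T, (γ s).im = 1) ∧ ContinuousOn (fun s => (γ s).re) (Set.Icc 0 T) ∧
      StrictAntiOn (fun s => (γ s).re) (Set.Icc 0 T)
  else
    ∃ φ : ℝ → ℝ, ContinuousOn φ (Set.Icc 0 T) ∧ StrictAntiOn φ (Set.Icc 0 T) ∧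
      ∀ s ∈ Set.Icc 0 T, (γ s : ℂ) =
        ((p : ℂ) / (q : ℂ) + Complex.I / (2 * (q : ℂ) ^ 2)) +
          1 / (2 * (q : ℂ) ^ 2) * Complex.exp (φ s * Complex.I)

/-- The base points of the vectors `γ s`, `0 ≤ s ≤ T`, run clockwise along some Ford circle. -/
def ClockwiseArc (γ : ℝ → UnitTangent) (T : ℝ) : Prop :=
  ∃ p q : ℕ, p.Coprime q ∧ ClockwiseOn p q (fun s => (γ s).base) T

/-- `w` is obtained from `v` by applying `A ^ T`, moving clockwise along a Ford circle. -/
def MoveA (T : ℕ) (v w : UnitTangent) : Prop :=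
  w = v.act (matA T) ∧ ClockwiseArc (fun s => v.act (matA s)) T

/-- `w` is obtained from `v` by applying `D ^ T`, moving clockwise along a Ford circle. -/
def MoveD (T : ℕ) (v w : UnitTangent) : Prop :=
  w = v.act (matD T) ∧ ClockwiseArc (fun s => v.act (matD s)) T

/-- `w` is obtained from `v` by applying the product `D ^ S * A ^ T` (first `D ^ S`, then `A ^ T`,
as matrices multiply from the right), moving clockwise along Ford circles. -/
def MoveDA (S T : ℕ) (v w : UnitTangent) : Prop :=
  w = v.act (matD S * matA T) ∧ ∃ u, MoveD S v u ∧ MoveA T u w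

/-- The same for the product `A ^ S * D ^ T`. -/
def MoveAD (S T : ℕ) (v w : UnitTangent) : Prop :=
  w = v.act (matA S * matD T) ∧ ∃ u, MoveA S v u ∧ MoveD T u w

/-- The vector `v` corresponds to the positive rational `x`: if `X` is the matrix formed from the
parents of `x`, then `v` is the vector of `X` or its opposite. -/
def Corresponds (v : UnitTangent) (x : ℚ) : Prop :=
  ∃ P : FareyPair, P.mediant = x ∧
    (v = UnitTangent.ofSL P.toSL ∨ v = (UnitTangent.ofSL P.toSL).opposite)

end SternBrocot

end

namespace SternBrocot

open UnitTangent

-- A flow by `matA` fixes the second column of a matrix and one by `matD` the first. That column is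
-- the boundary point where the horocycle is based; if up to sign it is a reduced fraction `p / q`,
-- the horocycle is the Ford circle of `p / q` (`clockwiseOn_matA`, `clockwiseArc_matD`).
--
-- Neighbours in a row have pairs `P`, `Q` sharing a fraction, `P.n / P.t = Q.m / Q.s`, and their
-- outer ends add up to `T` times it, with `T = 1 + 2 * p` (`adjacent_node`). Hence `P.toSL * matD T
-- = Q.toSL * halfTurn`: the move follows the Ford circle of the shared fraction and arrives with
-- the opposite vector. From the opposite vector the same move is by `matA`, so the two flows
-- alternate along a row.
--
-- At the end of a row the pairs are explicit: one flow along the line at height one leads back to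
-- `i`, the next follows the Ford circle of `0 / 1` (`moveDA_vec`, `moveAD_vec`).

/- ### The pairs of the tree, indexed row by row -/

/-- The Farey pair whose mediant is the `m`-th element of the tree, read row by row. The children
of the `m`-th element are the elements number `2 m` and `2 m + 1`. -/
def node : ℕ → FareyPair
  -- A default value: indices start at `1`.
  | 0 => FareyPair.root
  | 1 => FareyPair.root
  | m + 2 => if (m + 2) % 2 = 0 then (node ((m + 2) / 2)).left else (node ((m + 2) / 2)).right

theorem node_one : node 1 = FareyPair.root := by rw [node]

theorem node_two_mul {m : ℕ} (hm : 1 ≤ m) : node (2 * m) = (node m).left := by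
  obtain ⟨j, rfl⟩ := Nat.exists_eq_add_of_le' hm
  rw [show 2 * (j + 1) = 2 * j + 2 by ring, node, if_pos (by omega),
    show (2 * j + 2) / 2 = j + 1 by omega]

theorem node_two_mul_add_one {m : ℕ} (hm : 1 ≤ m) : node (2 * m + 1) = (node m).right := by
  obtain ⟨j, rfl⟩ := Nat.exists_eq_add_of_le' hm
  rw [show 2 * (j + 1) + 1 = (2 * j + 1) + 2 by ring, node, if_neg (by omega),
    show (2 * j + 1 + 2) / 2 = j + 1 by omega]

theorem flatMap_range_pair {α : Type*} (f : ℕ → α) (N : ℕ) :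
    (List.range N).flatMap (fun i => [f (2 * i), f (2 * i + 1)]) =
      (List.range (2 * N)).map f := by
  induction N with
  | zero => rfl
  | succ N ih =>
    rw [List.range_succ, List.flatMap_append, ih, show 2 * (N + 1) = 2 * N + 1 + 1 by ring,
      List.range_succ, List.range_succ]
    simp

theorem pairs_succ (j : ℕ) :
    pairs (j + 1) = (List.range (2 ^ j)).map (fun i => node (2 ^ j + i)) := by
  induction j with
  | zero => simp [pairs, node_one]
  | succ j ih =>
    rw [pairs, ih, List.flatMap_map, pow_succ, mul_comm (2 ^ j) 2, ← flatMap_range_pair]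
    congr 1
    funext i
    have h : 1 ≤ 2 ^ j + i := le_add_right Nat.one_le_two_pow
    rw [← node_two_mul h, ← node_two_mul_add_one h]
    ring_nf

theorem level_succ (j : ℕ) :
    level (j + 1) = (List.range (2 ^ j)).map (fun i => (node (2 ^ j + i)).mediant) := by
  rw [level, pairs_succ, List.map_map]
  rfl

/-- Level `0` is empty, so the range up to `j` contributes `1 + 2 + ... + 2 ^ (j - 1)` entries. -/
theorem flatMap_level (j : ℕ) : (List.range (j + 1)).flatMap level =
    (List.range (2 ^ j - 1)).map (fun i => (node (i + 1)).mediant) := by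
  induction j with
  | zero => simp [level, pairs]
  | succ j ih =>
    have h : 1 ≤ 2 ^ j := Nat.one_le_two_pow
    rw [List.range_succ, List.flatMap_append, ih, List.flatMap_singleton, level_succ,
      show 2 ^ (j + 1) - 1 = (2 ^ j - 1) + 2 ^ j by rw [pow_succ]; omega, List.range_add,
      List.map_append, List.map_map]
    congr 2
    funext i
    simp only [Function.comp]
    congr 2
    omega

theorem r_eq {m : ℕ} (hm : 1 ≤ m) : r m = (node m).mediant := by
  have h : m - 1 < 2 ^ m - 1 := by have := m.lt_two_pow_self; omega
  rw [r, flatMap_level, List.getD_eq_getElem?_getD, List.getElem?_map, List.getElem?_range h,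
    Option.map_some, Option.getD_some, Nat.sub_add_cancel hm]

theorem level_getElem? {n k : ℕ} (hn : 1 ≤ n) (hk : 1 ≤ k) (hkn : k ≤ 2 ^ (n - 1)) :
    (level n)[k - 1]? = some (r (2 ^ (n - 1) + (k - 1))) := by
  obtain ⟨j, rfl⟩ := Nat.exists_eq_add_of_le' hn
  rw [Nat.add_sub_cancel] at hkn ⊢
  rw [level_succ, r_eq (le_add_right Nat.one_le_two_pow), List.getElem?_map,
    List.getElem?_range (by omega), Option.map_some]

/- ### Neighbours in a row -/

/-- `Q` starts where `P` ends, and the outer ends of both add up to `T` times the common end. -/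
structure Adjacent (T : ℕ) (P Q : FareyPair) : Prop where
  m_eq : Q.m = P.n
  s_eq : Q.s = P.t
  n_add : Q.n + P.m = T * P.n
  t_add : Q.t + P.s = T * P.t

/-- Siblings have `T = 1`. Below neighbours, the next pair to meet is a right child and a left
child; each has replaced its outer end by a mediant, which adds the common end once on either side,
so `T` grows by `2`. -/
theorem adjacent_node {a : ℕ} (ha : 1 ≤ a) (p : ℕ) :
    Adjacent (1 + 2 * p) (node (2 ^ p * (2 * a + 1) - 1)) (node (2 ^ p * (2 * a + 1))) := by
  induction p with
  | zero =>
    rw [pow_zero, one_mul, Nat.add_sub_cancel, node_two_mul ha, node_two_mul_add_one ha]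
    constructor <;> simp [FareyPair.left, FareyPair.right] <;> ring
  | succ p ih =>
    have h1 : 3 ≤ 2 ^ p * (2 * a + 1) := by
      have : 1 ≤ 2 ^ p := Nat.one_le_two_pow
      nlinarith
    obtain ⟨h2, h3, h4, h5⟩ := ih
    rw [show 2 ^ (p + 1) * (2 * a + 1) = 2 * (2 ^ p * (2 * a + 1)) by ring,
      node_two_mul (by omega),
      show 2 * (2 ^ p * (2 * a + 1)) - 1 = 2 * (2 ^ p * (2 * a + 1) - 1) + 1 by omega,
      node_two_mul_add_one (by omega)]
    constructor <;> simp only [FareyPair.left, FareyPair.right]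
    · exact h2
    · exact h3
    · rw [h2]; linarith
    · rw [h3]; linarith

theorem node_two_pow (j : ℕ) : node (2 ^ j) = ⟨0, 1, 1, j, by simp⟩ := by
  induction j with
  | zero => exact node_one
  | succ j ih =>
    rw [pow_succ, mul_comm, node_two_mul Nat.one_le_two_pow, ih]
    simp [FareyPair.left, add_comm]

theorem node_two_pow_sub_one (j : ℕ) : node (2 ^ (j + 1) - 1) = ⟨j, 1, 1, 0, by simp⟩ := by
  induction j with
  | zero => exact node_one
  | succ j ih =>
    have h : 2 ≤ 2 ^ (j + 1) := Nat.le_self_pow (by omega) 2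
    rw [show 2 ^ (j + 1 + 1) - 1 = 2 * (2 ^ (j + 1) - 1) + 1 by rw [pow_succ _ (j + 1)]; omega,
      node_two_mul_add_one (by omega), ih]
    simp [FareyPair.right]

/-- If `0 < k < 2 ^ j`, then `2 ^ j + k` has the same power of two as `k`, and an odd part
greater than one. -/
theorem exists_odd_part {j k p : ℕ} (hkj : k < 2 ^ j)
    (hp : k ≡ 2 ^ p [MOD 2 ^ (p + 1)]) :
    ∃ a, 1 ≤ a ∧ 2 ^ j + k = 2 ^ p * (2 * a + 1) := by
  have hlt : 2 ^ p < 2 ^ (p + 1) := Nat.pow_lt_pow_right (by norm_num) (by omega)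
  have hmod : k % 2 ^ (p + 1) = 2 ^ p := by rw [hp, Nat.mod_eq_of_lt hlt]
  have hdiv := Nat.div_add_mod k (2 ^ (p + 1))
  rw [hmod] at hdiv
  have hpj : p < j := (Nat.pow_lt_pow_iff_right (a := 2) (by norm_num)).mp (by omega)
  obtain ⟨i, rfl⟩ := Nat.exists_eq_add_of_lt hpj
  -- Here `j = p + i + 1`, so `2 ^ j` is `2 ^ (p + 1)` times `2 ^ i`.
  refine ⟨2 ^ i + k / 2 ^ (p + 1), le_add_right Nat.one_le_two_pow, ?_⟩
  conv_lhs => rw [← hdiv]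
  ring

/- ### Half turns -/

/-- The matrix of the half turn of a vector around its base point. -/
def halfTurn : SL(2, ℝ) := ⟨!![0, -1; 1, 0], by simp [Matrix.det_fin_two_of]⟩

theorem ext_SL {g h : SL(2, ℝ)} (h00 : g 0 0 = h 0 0) (h01 : g 0 1 = h 0 1)
    (h10 : g 1 0 = h 1 0) (h11 : g 1 1 = h 1 1) : g = h := by
  ext i j
  fin_cases i <;> fin_cases j <;> assumption

theorem mul_SL_apply (g h : SL(2, ℝ)) (i j : Fin 2) :
    (g * h) i j = g i 0 * h 0 j + g i 1 * h 1 j := by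
  rw [Matrix.SpecialLinearGroup.coe_mul, Matrix.mul_apply, Fin.sum_univ_two]

theorem mul_halfTurn (g : SL(2, ℝ)) : (g * halfTurn) 0 0 = g 0 1 ∧ (g * halfTurn) 0 1 = -g 0 0 ∧
    (g * halfTurn) 1 0 = g 1 1 ∧ (g * halfTurn) 1 1 = -g 1 0 := by
  simp only [mul_SL_apply]
  simp [halfTurn]

theorem mul_matA (g : SL(2, ℝ)) (t : ℝ) : (g * matA t) 0 0 = g 0 0 + g 0 1 * t ∧
    (g * matA t) 0 1 = g 0 1 ∧ (g * matA t) 1 0 = g 1 0 + g 1 1 * t ∧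
    (g * matA t) 1 1 = g 1 1 := by
  simp only [mul_SL_apply]
  simp [matA]

theorem mul_matD (g : SL(2, ℝ)) (t : ℝ) : (g * matD t) 0 0 = g 0 0 ∧
    (g * matD t) 0 1 = g 0 1 - g 0 0 * t ∧ (g * matD t) 1 0 = g 1 0 ∧
    (g * matD t) 1 1 = g 1 1 - g 1 0 * t := by
  simp only [mul_SL_apply]
  simp [matD]
  constructor <;> ring

/-- The map `z ↦ -1 / z` fixes `i` and has derivative `-1` there. -/
theorem ofSL_mul_halfTurn (g : SL(2, ℝ)) : ofSL (g * halfTurn) = (ofSL g).opposite := by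
  have h0 := denom_ne_zero g
  have h0' := denom_ne_zero (g * halfTurn)
  obtain ⟨h00, h01, h10, h11⟩ := mul_halfTurn g
  rw [h10, h11] at h0'
  push_cast at h0'
  ext1
  · apply UpperHalfPlane.ext
    simp only [ofSL, opposite]
    rw [coe_smul_I, coe_smul_I, h00, h01, h10, h11]
    push_cast
    rw [div_eq_div_iff h0' h0]
    linear_combination ((g 0 1 : ℂ) * g 1 0 - g 0 0 * g 1 1) * Complex.I_sq
  · simp only [ofSL, opposite]
    rw [h10, h11]
    push_cast
    have : ((g 1 1 : ℂ) * Complex.I + -(g 1 0 : ℂ)) ^ 2 =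
        -(((g 1 0 : ℂ) * Complex.I + (g 1 1 : ℂ)) ^ 2) := by
      linear_combination ((g 1 1 : ℂ) ^ 2 + (g 1 0 : ℂ) ^ 2) * Complex.I_sq
    rw [this, div_neg]

/- ### Horocyclic arcs -/

/-- The tangent half-angle parametrization of the unit circle, normalized so that `u = 0` is the top
point and the angle decreases in `u`. -/
theorem exp_arctan (u : ℝ) :
    Complex.exp (((Real.pi / 2 - 2 * Real.arctan u : ℝ) : ℂ) * Complex.I) =
      Complex.I * (1 - u * Complex.I) / (1 + u * Complex.I) := by
  have hu : (0 : ℝ) < 1 + u ^ 2 := by positivity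
  have hs : Real.sqrt (1 + u ^ 2) ^ 2 = 1 + u ^ 2 := Real.sq_sqrt hu.le
  have hs0 : Real.sqrt (1 + u ^ 2) ≠ 0 := (Real.sqrt_pos.mpr hu).ne'
  have hc : Real.cos (Real.pi / 2 - 2 * Real.arctan u) = 2 * u / (1 + u ^ 2) := by
    rw [Real.cos_pi_div_two_sub, Real.sin_two_mul, Real.sin_arctan, Real.cos_arctan]
    field_simp
    rw [hs]
  have hsn : Real.sin (Real.pi / 2 - 2 * Real.arctan u) = (1 - u ^ 2) / (1 + u ^ 2) := by
    rw [Real.sin_pi_div_two_sub, Real.cos_two_mul, Real.cos_arctan, div_pow, hs]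
    field_simp
    ring
  have h1 : (1 + u * Complex.I : ℂ) ≠ 0 := by
    intro h
    have := congrArg Complex.re h
    simp at this
  have h2 : (1 + (u : ℂ) ^ 2) ≠ 0 := by exact_mod_cast hu.ne'
  rw [Complex.exp_mul_I, ← Complex.ofReal_cos, ← Complex.ofReal_sin, hc, hsn]
  push_cast
  field_simp
  linear_combination 2 * (u : ℂ) * Complex.I_sq

/-- The column `(x, y)` represents a nonnegative reduced fraction. -/
def IsReducedColumn (x y : ℝ) : Prop :=
  ∃ p q : ℕ, p.Coprime q ∧ ((x = p ∧ y = q) ∨ (x = -p ∧ y = -q))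

theorem IsReducedColumn.neg {x y : ℝ} (h : IsReducedColumn x y) : IsReducedColumn (-x) (-y) := by
  obtain ⟨p, q, hpq, ⟨rfl, rfl⟩ | ⟨rfl, rfl⟩⟩ := h
  · exact ⟨p, q, hpq, Or.inr ⟨rfl, rfl⟩⟩
  · exact ⟨p, q, hpq, Or.inl ⟨neg_neg _, neg_neg _⟩⟩

theorem clockwiseOn_matA {p q : ℕ} (hpq : p.Coprime q) {g : SL(2, ℝ)} (hp : g 0 1 = p)
    (hq : g 1 1 = q) (T : ℝ) : ClockwiseOn p q (fun s => (ofSL (g * matA s)).base) T := by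
  have hbase : ∀ s : ℝ, (((ofSL (g * matA s)).base : ℍ) : ℂ) =
      (((g 0 0 + p * s : ℝ) : ℂ) * Complex.I + p) /
        (((g 1 0 + q * s : ℝ) : ℂ) * Complex.I + q) := by
    intro s
    obtain ⟨h00, h01, h10, h11⟩ := mul_matA g s
    simp only [ofSL]
    rw [coe_smul_I, h00, h01, h10, h11, hp, hq]
    push_cast
    rfl
  have hdet := det_eq g
  rw [hp, hq] at hdet
  rw [ClockwiseOn]
  split_ifs with h0
  · subst h0
    -- Coprimality with `0` leaves only the fraction `1 / 0`.
    obtain rfl : p = 1 := by simpa using hpq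
    have hc : g 1 0 = -1 := by push_cast at hdet; linarith
    have hz : ∀ s : ℝ, (((ofSL (g * matA s)).base : ℍ) : ℂ) =
        ((-(g 0 0 + s) : ℝ) : ℂ) + Complex.I := by
      intro s
      rw [hbase, hc]
      push_cast
      rw [div_eq_iff (by simp)]
      linear_combination Complex.I_sq
    have hre : ∀ s : ℝ, (ofSL (g * matA s)).base.re = -(g 0 0 + s) := by
      intro s
      rw [← UpperHalfPlane.coe_re, hz]
      simp
    refine ⟨fun s _ => ?_, ?_, ?_⟩
    · rw [← UpperHalfPlane.coe_im, hz]
      simp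
    · simp only [hre]
      fun_prop
    · intro x _ y _ hxy
      simp only [hre]
      linarith
  · have hq0 : (q : ℝ) ≠ 0 := by exact_mod_cast h0
    have hqC : (q : ℂ) ≠ 0 := by exact_mod_cast h0
    -- With `u = g 1 0 / q + s` and determinant one, the base point is `p / q + i / (q ^ 2 * (1 + u
    -- * i))`, whose direction from the centre is the quotient in `exp_arctan`.
    refine ⟨fun s => Real.pi / 2 - 2 * Real.arctan (g 1 0 / q + s), ?_, ?_, ?_⟩
    · exact (continuous_const.sub (continuous_const.mul
        (Real.continuous_arctan.comp (continuous_const.add continuous_id)))).continuousOn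
    · intro x _ y _ hxy
      have : Real.arctan (g 1 0 / q + x) < Real.arctan (g 1 0 / q + y) :=
        Real.arctan_strictMono (by linarith)
      simp only
      linarith
    · intro s _
      rw [hbase, exp_arctan]
      obtain ⟨u, hu⟩ : ∃ u : ℝ, u = g 1 0 / q + s := ⟨_, rfl⟩
      have hc : g 1 0 + q * s = q * u := by rw [hu]; field_simp
      have ha : (g 0 0 + p * s) * q = 1 + p * (q * u) := by
        rw [← hc]; linear_combination hdet
      have haC : ((g 0 0 + p * s : ℝ) : ℂ) = (1 + p * (q * u)) / q := by
        rw [eq_div_iff hqC]; exact_mod_cast ha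
      rw [← hu, haC, hc]
      have h1 : (1 + u * Complex.I : ℂ) ≠ 0 := by
        intro h
        have := congrArg Complex.re h
        simp at this
      have h2 : ((q * u : ℝ) : ℂ) * Complex.I + q = q * (1 + u * Complex.I) := by
        push_cast; ring
      rw [h2]
      field_simp
      ring

theorem clockwiseArc_matA {g : SL(2, ℝ)} (hg : IsReducedColumn (g 0 1) (g 1 1)) (T : ℝ) :
    ClockwiseArc (fun s => (ofSL g).act (matA s)) T := by
  obtain ⟨p, q, hpq, ⟨hp, hq⟩ | ⟨hp, hq⟩⟩ := hg
  · refine ⟨p, q, hpq, ?_⟩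
    simp only [act_ofSL]
    exact clockwiseOn_matA hpq hp hq T
  · refine ⟨p, q, hpq, ?_⟩
    rw [← ofSL_neg]
    simp only [act_ofSL]
    refine clockwiseOn_matA hpq ?_ ?_ T <;> simp [hp, hq]

/-- The half turn conjugates `matD s` into `matA s`, swaps the columns up to sign and keeps base
points. -/
theorem clockwiseArc_matD {g : SL(2, ℝ)} (hg : IsReducedColumn (g 0 0) (g 1 0)) (T : ℝ) :
    ClockwiseArc (fun s => (ofSL g).act (matD s)) T := by
  have h : IsReducedColumn ((g * halfTurn) 0 1) ((g * halfTurn) 1 1) := by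
    obtain ⟨-, h01, -, h11⟩ := mul_halfTurn g
    rw [h01, h11]
    exact hg.neg
  obtain ⟨p, q, hpq, hc⟩ := clockwiseArc_matA h T
  refine ⟨p, q, hpq, ?_⟩
  convert hc using 2 with s
  have hs : g * halfTurn * matA s = g * matD s * halfTurn := by
    rw [mul_assoc, mul_assoc]
    congr 1
    apply ext_SL <;> simp only [mul_SL_apply] <;> simp [halfTurn, matA, matD]
  beta_reduce
  rw [act_ofSL, act_ofSL, hs, ofSL_mul_halfTurn]
  rfl

theorem moveA_ofSL {g : SL(2, ℝ)} (hg : IsReducedColumn (g 0 1) (g 1 1)) (T : ℕ) :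
    MoveA T (ofSL g) (ofSL (g * matA T)) :=
  ⟨(act_ofSL g _).symm, clockwiseArc_matA hg T⟩

theorem moveD_ofSL {g : SL(2, ℝ)} (hg : IsReducedColumn (g 0 0) (g 1 0)) (T : ℕ) :
    MoveD T (ofSL g) (ofSL (g * matD T)) :=
  ⟨(act_ofSL g _).symm, clockwiseArc_matD hg T⟩

theorem moveDA_ofSL {g : SL(2, ℝ)} (S T : ℕ) (hg : IsReducedColumn (g 0 0) (g 1 0))
    (hg' : IsReducedColumn ((g * matD S) 0 1) ((g * matD S) 1 1)) :
    MoveDA S T (ofSL g) (ofSL (g * matD S * matA T)) :=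
  ⟨by rw [act_ofSL, mul_assoc], _, moveD_ofSL hg S, moveA_ofSL hg' T⟩

theorem moveAD_ofSL {g : SL(2, ℝ)} (S T : ℕ) (hg : IsReducedColumn (g 0 1) (g 1 1))
    (hg' : IsReducedColumn ((g * matA S) 0 0) ((g * matA S) 1 0)) :
    MoveAD S T (ofSL g) (ofSL (g * matA S * matD T)) :=
  ⟨by rw [act_ofSL, mul_assoc], _, moveA_ofSL hg S, moveD_ofSL hg' T⟩

/- ### Moves between elements of the tree -/

theorem FareyPair.toSL_apply (P : FareyPair) : P.toSL 0 0 = P.n ∧ P.toSL 0 1 = P.m ∧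
    P.toSL 1 0 = P.t ∧ P.toSL 1 1 = P.s := ⟨rfl, rfl, rfl, rfl⟩

theorem FareyPair.isReducedColumn_right (P : FareyPair) : IsReducedColumn P.n P.t := by
  refine ⟨P.n, P.t, ?_, Or.inl ⟨rfl, rfl⟩⟩
  rw [← Nat.isCoprime_iff_coprime]
  refine ⟨P.s, -P.m, ?_⟩
  have h : (P.n : ℤ) * P.s = P.m * P.t + 1 := by exact_mod_cast P.unimodular
  linarith

theorem moveD_of_adjacent {T : ℕ} {P Q : FareyPair} (h : Adjacent T P Q) :
    MoveD T (ofSL P.toSL) (ofSL (Q.toSL * halfTurn)) := by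
  have e : Q.toSL * halfTurn = P.toSL * matD T := by
    obtain ⟨a1, a2, a3, a4⟩ := mul_halfTurn Q.toSL
    obtain ⟨b1, b2, b3, b4⟩ := mul_matD P.toSL T
    obtain ⟨c1, c2, c3, c4⟩ := P.toSL_apply
    obtain ⟨d1, d2, d3, d4⟩ := Q.toSL_apply
    have hn : (Q.n : ℝ) + P.m = T * P.n := by exact_mod_cast h.n_add
    have ht : (Q.t : ℝ) + P.s = T * P.t := by exact_mod_cast h.t_add
    apply ext_SL
    · rw [a1, b1, c1, d2, h.m_eq]
    · rw [a2, b2, c1, c2, d1]; linarith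
    · rw [a3, b3, c3, d4, h.s_eq]
    · rw [a4, b4, c3, c4, d3]; linarith
  rw [e]
  exact moveD_ofSL P.isReducedColumn_right T

theorem moveA_of_adjacent {T : ℕ} {P Q : FareyPair} (h : Adjacent T P Q) :
    MoveA T (ofSL (P.toSL * halfTurn)) (ofSL Q.toSL) := by
  obtain ⟨a1, a2, a3, a4⟩ := mul_halfTurn P.toSL
  -- Two half turns give `-1`, which is invisible on vectors.
  have e : -Q.toSL = P.toSL * halfTurn * matA T := by
    obtain ⟨b1, b2, b3, b4⟩ := mul_matA (P.toSL * halfTurn) T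
    obtain ⟨c1, c2, c3, c4⟩ := P.toSL_apply
    obtain ⟨d1, d2, d3, d4⟩ := Q.toSL_apply
    have hn : (Q.n : ℝ) + P.m = T * P.n := by exact_mod_cast h.n_add
    have ht : (Q.t : ℝ) + P.s = T * P.t := by exact_mod_cast h.t_add
    apply ext_SL <;>
      simp only [Matrix.SpecialLinearGroup.coe_neg, Matrix.neg_apply]
    · rw [b1, a1, a2, c1, c2, d1]; linarith
    · rw [b2, a2, c1, d2, h.m_eq]
    · rw [b3, a3, a4, c3, c4, d3]; linarith
    · rw [b4, a4, c3, d4, h.s_eq]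
  rw [← ofSL_neg Q.toSL, e]
  apply moveA_ofSL
  rw [a2, a4]
  exact P.isReducedColumn_right.neg

/-- The vector at the `m`-th element of the tree; its orientation alternates along a row. -/
noncomputable def vec (m : ℕ) : UnitTangent :=
  if Odd (Nat.log 2 m + m) then ofSL (node m).toSL else ofSL ((node m).toSL * halfTurn)

theorem vec_of_odd {m : ℕ} (h : Odd (Nat.log 2 m + m)) : vec m = ofSL (node m).toSL := if_pos h

theorem vec_of_even {m : ℕ} (h : Even (Nat.log 2 m + m)) :
    vec m = ofSL ((node m).toSL * halfTurn) := if_neg (Nat.not_odd_iff_even.mpr h)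

theorem log_two_pow_add {j i : ℕ} (h : i < 2 ^ j) : Nat.log 2 (2 ^ j + i) = j :=
  Nat.log_eq_of_pow_le_of_lt_pow (Nat.le_add_right _ _) (by rw [pow_succ]; omega)

theorem vec_one : vec 1 = ofSL 1 := by
  rw [vec_of_odd (by simp), node_one]
  congr 1
  apply ext_SL <;> simp [FareyPair.toSL, FareyPair.root]

theorem corresponds_vec {m : ℕ} (hm : 1 ≤ m) : Corresponds (vec m) (r m) := by
  refine ⟨node m, (r_eq hm).symm, ?_⟩
  rcases Nat.even_or_odd (Nat.log 2 m + m) with h | h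
  · exact Or.inr (by rw [vec_of_even h, ofSL_mul_halfTurn])
  · exact Or.inl (vec_of_odd h)

theorem log_two_pow_succ_sub_one (j : ℕ) : Nat.log 2 (2 ^ (j + 1) - 1) = j := by
  have h : 1 ≤ 2 ^ j := Nat.one_le_two_pow
  rw [show 2 ^ (j + 1) - 1 = 2 ^ j + (2 ^ j - 1) by rw [pow_succ]; omega]
  exact log_two_pow_add (by omega)

theorem moveDA_vec {j : ℕ} (hj : Even j) :
    MoveDA j (j + 1) (vec (2 ^ (j + 1) - 1)) (vec (2 ^ (j + 1))) := by
  have h : 2 ^ (j + 1) = 2 * 2 ^ j := by ring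
  have h' : 1 ≤ 2 ^ j := Nat.one_le_two_pow
  have e1 : Odd (Nat.log 2 (2 ^ (j + 1) - 1) + (2 ^ (j + 1) - 1)) := by
    rw [log_two_pow_succ_sub_one]
    exact hj.add_odd ⟨2 ^ j - 1, by omega⟩
  have e2 : Odd (Nat.log 2 (2 ^ (j + 1)) + 2 ^ (j + 1)) := by
    rw [Nat.log_pow (by norm_num)]
    exact hj.add_one.add_even ⟨2 ^ j, by omega⟩
  rw [vec_of_odd e1, vec_of_odd e2, node_two_pow, node_two_pow_sub_one]
  set g : SL(2, ℝ) := FareyPair.toSL ⟨j, 1, 1, 0, by simp⟩ with hg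
  -- The intermediate vector is the upward one at `i`.
  have hgD : g * matD j = 1 := by
    apply ext_SL <;> simp only [mul_SL_apply] <;> simp [hg, FareyPair.toSL, matD]
  have e : FareyPair.toSL ⟨0, 1, 1, j + 1, by simp⟩ = g * matD j * matA (j + 1 : ℕ) := by
    rw [hgD, one_mul (matA _)]
    apply ext_SL <;> simp [FareyPair.toSL, matA]
  rw [e]
  apply moveDA_ofSL
  · exact FareyPair.isReducedColumn_right ⟨j, 1, 1, 0, by simp⟩
  · rw [hgD]
    exact ⟨0, 1, by simp, by simp⟩

theorem moveAD_vec {j : ℕ} (hj : Odd j) :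
    MoveAD j (j + 1) (vec (2 ^ (j + 1) - 1)) (vec (2 ^ (j + 1))) := by
  have h : 2 ^ (j + 1) = 2 * 2 ^ j := by ring
  have h' : 1 ≤ 2 ^ j := Nat.one_le_two_pow
  have e1 : Even (Nat.log 2 (2 ^ (j + 1) - 1) + (2 ^ (j + 1) - 1)) := by
    rw [log_two_pow_succ_sub_one]
    exact hj.add_odd ⟨2 ^ j - 1, by omega⟩
  have e2 : Even (Nat.log 2 (2 ^ (j + 1)) + 2 ^ (j + 1)) := by
    rw [Nat.log_pow (by norm_num)]
    exact hj.add_one.add ⟨2 ^ j, by omega⟩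
  rw [vec_of_even e1, vec_of_even e2, node_two_pow, node_two_pow_sub_one]
  set g : SL(2, ℝ) := FareyPair.toSL ⟨j, 1, 1, 0, by simp⟩ with hg
  -- The intermediate vector is the downward one at `i`.
  have hgA : g * halfTurn * matA j = halfTurn := by
    apply ext_SL <;> simp only [mul_SL_apply] <;> simp [hg, FareyPair.toSL, halfTurn, matA]
  have e : FareyPair.toSL ⟨0, 1, 1, j + 1, by simp⟩ * halfTurn =
      g * halfTurn * matA j * matD (j + 1 : ℕ) := by
    rw [hgA]
    apply ext_SL <;> simp only [mul_SL_apply] <;> simp [FareyPair.toSL, halfTurn, matD]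
  rw [e]
  obtain ⟨-, a2, -, a4⟩ := mul_halfTurn g
  apply moveAD_ofSL
  · rw [a2, a4]
    exact (FareyPair.isReducedColumn_right ⟨j, 1, 1, 0, by simp⟩).neg
  · rw [hgA]
    exact ⟨0, 1, by simp, by simp [halfTurn]⟩

theorem move_vec_row {j k p : ℕ} (hk : 1 ≤ k) (hkj : k < 2 ^ j)
    (hp : k ≡ 2 ^ p [MOD 2 ^ (p + 1)]) :
    (Odd (j + k) → MoveA (1 + 2 * p) (vec (2 ^ j + (k - 1))) (vec (2 ^ j + k))) ∧
      (Even (j + k) → MoveD (1 + 2 * p) (vec (2 ^ j + (k - 1))) (vec (2 ^ j + k))) := by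
  obtain ⟨a, ha, hak⟩ := exists_odd_part hkj hp
  have hadj := adjacent_node ha p
  rw [← hak, show 2 ^ j + k - 1 = 2 ^ j + (k - 1) by omega] at hadj
  -- Since `1 ≤ k < 2 ^ j` forces `j ≥ 1`, the orientation in this row depends only on the parity of
  -- `j + k`.
  have h2 : 2 ^ j % 2 = 0 := by
    obtain ⟨i, rfl⟩ : ∃ i, j = i + 1 := Nat.exists_eq_succ_of_ne_zero (by rintro rfl; omega)
    rw [pow_succ]; omega
  constructor <;> intro hpar
  · rw [vec_of_even, vec_of_odd]
    · exact moveA_of_adjacent hadj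
    · rw [log_two_pow_add hkj]
      rw [Nat.odd_iff] at *; omega
    · rw [log_two_pow_add (by omega)]
      rw [Nat.odd_iff] at hpar; rw [Nat.even_iff]; omega
  · rw [vec_of_odd, vec_of_even]
    · exact moveD_of_adjacent hadj
    · rw [log_two_pow_add hkj]
      rw [Nat.even_iff] at *; omega
    · rw [log_two_pow_add (by omega)]
      rw [Nat.even_iff] at hpar; rw [Nat.odd_iff]; omega

end SternBrocot

theorem theorem5p2 :
    -- the `k`-th element of level `n` is `r (2 ^ (n - 1) + (k - 1))`
    (∀ n k : ℕ, 1 ≤ n → 1 ≤ k → k ≤ 2 ^ (n - 1) →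
      (SternBrocot.level n)[k - 1]? = some (SternBrocot.r (2 ^ (n - 1) + (k - 1)))) ∧
    ∃ v : ℕ → SternBrocot.UnitTangent,
      v 1 = SternBrocot.UnitTangent.ofSL 1 ∧
      (∀ m : ℕ, 1 ≤ m → SternBrocot.Corresponds (v m) (SternBrocot.r m)) ∧
      -- from the rightmost element of level `n` to the next level
      (∀ n m : ℕ, 1 ≤ n → m = 2 ^ n - 1 →
        (Odd n → SternBrocot.MoveDA (n - 1) n (v m) (v (m + 1))) ∧
        (Even n → SternBrocot.MoveAD (n - 1) n (v m) (v (m + 1)))) ∧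
      -- from the `k`-th element of level `n` to the next one on the same level
      (∀ n k p m : ℕ, 1 ≤ n → 1 ≤ k → k < 2 ^ (n - 1) → m = 2 ^ (n - 1) + (k - 1) →
        1 ≤ p → k ≡ 2 ^ (p - 1) [MOD 2 ^ p] →
        (n ≡ k [MOD 2] → SternBrocot.MoveA (1 + 2 * (p - 1)) (v m) (v (m + 1))) ∧
        (¬ n ≡ k [MOD 2] → SternBrocot.MoveD (1 + 2 * (p - 1)) (v m) (v (m + 1)))) := by
  refine ⟨fun n k => SternBrocot.level_getElem?, SternBrocot.vec, SternBrocot.vec_one,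
    fun m => SternBrocot.corresponds_vec, ?_, ?_⟩
  · rintro n m hn rfl
    obtain ⟨j, rfl⟩ := Nat.exists_eq_add_of_le' hn
    rw [Nat.sub_add_cancel Nat.one_le_two_pow, Nat.add_sub_cancel]
    constructor <;> intro hpar
    · exact SternBrocot.moveDA_vec (by rw [Nat.odd_iff] at hpar; rw [Nat.even_iff]; omega)
    · exact SternBrocot.moveAD_vec (by rw [Nat.even_iff] at hpar; rw [Nat.odd_iff]; omega)
  · rintro n k p m hn hk hkn rfl hp hmod
    obtain ⟨j, rfl⟩ := Nat.exists_eq_add_of_le' hn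
    obtain ⟨i, rfl⟩ := Nat.exists_eq_add_of_le' hp
    rw [Nat.add_sub_cancel] at hkn hmod
    rw [Nat.add_sub_cancel, Nat.add_sub_cancel]
    rw [show 2 ^ j + (k - 1) + 1 = 2 ^ j + k by omega]
    obtain ⟨hA, hD⟩ := SternBrocot.move_vec_row hk hkn hmod
    unfold Nat.ModEq
    constructor <;> intro hpar
    -- The level is `j + 1`, so congruence to `k` modulo `2` means that `j + k` is odd.
    · exact hA (by rw [Nat.odd_iff]; omega)
    · exact hD (by rw [Nat.even_iff]; omega)
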